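/- Let $N$ be a non-negative integer and let $x\in\{0,1\}^N$ be a black-box input. On $\mathbb{C}^N\otimes\mathbb{C}^2\otimes\mathbb{C}^W$, where $\mathbb{C}^W$ is an arbitrary finite-dimensional workspace (possibly trivial), let $O_x|i,b,w\rangle=|i,b\oplus x_i,w\rangle$. In the continuous-time query model with time-independent driving Hamiltonian one evolves with $e^{-i(H_D+H_Q)t}$, where $H_Q=O_x$ and $H_D$ is an arbitrary Hermitian operator on this space that does not depend on $x$; the initial state and the final measurement also do not depend on $x$. In the conventional discrete-time query model an algorithm with $q$ queries performs $U_qO_xU_{q-1}O_x\cdots O_xU_0$ with unitaries $U_0,\dots,U_q$ that do not depend on $x$, on a space of the same form with a workspace of arbitrary finite dimension. Write $\mathrm{abs}(H_D)$ for the elementwise absolute value of $H_D$ in the basis $|i,b,w\rangle$ and $\|\cdot\|$ for the spectral norm. (1) For every $\varepsilon>0$ there is a constant $C_\varepsilon$ such that for all $N$, $W$, $H_D$ and $t\ge 0$ there is a discrete-time query algorithm, acting with an additional ancilla register, that makes at most $C_\varepsilon\,(1+\|\mathrm{abs}(H_D)\|\,t)$ queries and, for every $x\in\{0,1\}^N$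 and every unit vector $\psi$, maps $\psi\otimes|a\rangle$ to within distance $\varepsilon$ of $\big(e^{-i(H_D+H_Q)t}\psi\big)\otimes|a\rangle$, where $|a\rangle$ is a fixed basis state of the ancilla register. (2) There is an absolute constant $C$ such that if a continuous-time query algorithm with time-independent Hamiltonian $H_D+H_Q$ running for time $t$ computes a partial function $f$ of $x$ with error probability at most $1/3$, then some discrete-time query algorithm that makes at most $C\,(1+\|\mathrm{abs}(H_D)\|\,t)$ queries computes $f$ with error probability at most $1/3$. In particular, the bounded-error discrete query complexity of $f$ is $O(\|\mathrm{abs}(H_D)\|\,t)$ as soon as $\|\mathrm{abs}(H_D)\|\,t=\Omega(1)$. -/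

import Mathlib

noncomputable section

/-- Labels of the computational basis of `ℂ^N ⊗ ℂ^2 ⊗ ℂ^W`: a query index `i`, a bit `b`, and a
label of an additional workspace on which queries act trivially. -/
abbrev QIndex (N : ℕ) (W : Type) : Type := (Fin N × Bool) × W

/-- Pure states (not yet normalized) of the register, with the Euclidean norm. -/
abbrev QState (N : ℕ) (W : Type) : Type := EuclideanSpace ℂ (QIndex N W)

/-- Operators on the register, as matrices in the computational basis. -/
abbrev QOp (N : ℕ) (W : Type) : Type := Matrix (QIndex N W) (QIndex N W) ℂ

/-- The black box for the input `x`, mapping `|i, b, w⟩` to `|i, b ⊕ x_i, w⟩`.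
It is Hermitian and unitary: it serves as the query Hamiltonian in the continuous-time model and as
the query gate in the discrete-time model. -/
def queryOp {N : ℕ} (W : Type) [DecidableEq W] (x : Fin N → Bool) : QOp N W :=
  Matrix.of fun r c => if r = ((c.1.1, xor c.1.2 (x c.1.1)), c.2) then 1 else 0

/-- The elementwise absolute value of a matrix. -/
def absMatrix {ι : Type} (H : Matrix ι ι ℂ) : Matrix ι ι ℂ :=
  Matrix.of fun j k => ((‖H j k‖ : ℝ) : ℂ)

/-- The spectral norm: the operator norm with respect to the Euclidean norm. -/
def l2OpNorm {ι : Type} [Fintype ι] [DecidableEq ι] (M : Matrix ι ι ℂ) : ℝ :=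
  ‖Matrix.toEuclideanCLM (n := ι) (𝕜 := ℂ) M‖

/-- Action of a matrix on a state. -/
def applyOp {ι : Type} [Fintype ι] (M : Matrix ι ι ℂ) (ψ : EuclideanSpace ℂ ι) :
    EuclideanSpace ℂ ι :=
  WithLp.toLp 2 (M.mulVec (WithLp.ofLp ψ))

/-- The evolution operator `exp (-i (H_D + H_Q) t)` of the continuous-time query model with the
time-independent driving Hamiltonian `HD`, on the input `x`. -/
def continuousEvolution {N : ℕ} {W : Type} [Fintype W] [DecidableEq W]
    (HD : QOp N W) (t : ℝ) (x : Fin N → Bool) : QOp N W :=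
  NormedSpace.exp ((-(Complex.I * (t : ℂ))) • (HD + queryOp W x))

/-- The operator performed on the input `x` by the discrete-time algorithm that makes `q` queries
interleaved with the input-independent unitaries `U 0, …, U q`, that is
`U q * O_x * U (q-1) * ⋯ * O_x * U 0`. The later entries of the sequence are not used. -/
def discreteRun {N : ℕ} {W : Type} [Fintype W] [DecidableEq W]
    (U : ℕ → Matrix.unitaryGroup (QIndex N W) ℂ) (x : Fin N → Bool) : ℕ → QOp N W
  | 0 => (U 0 : QOp N W)
  | q + 1 => (U (q + 1) : QOp N W) * queryOp W x * discreteRun U x q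

/-- The state `ψ ⊗ |a⟩` with an ancilla register in the basis state `|a⟩` added to the
workspace. -/
def attach {N : ℕ} {W A : Type} [DecidableEq A] (a : A) (ψ : QState N W) : QState N (W × A) :=
  WithLp.toLp 2 fun p => if p.2.2 = a then ψ (p.1, p.2.1) else 0

open Classical in
/-- The probability that a measurement of `φ` in the computational basis, followed by the
classical postprocessing `out`, yields the result `y`. -/
def outcomeProb {ι Y : Type} [Fintype ι] (φ : EuclideanSpace ℂ ι) (out : ι → Y) (y : Y) : ℝ :=
  ∑ c : ι, if out c = y then ‖φ c‖ ^ 2 else 0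

/-- A continuous-time query algorithm with time-independent driving Hamiltonian: the Hamiltonian,
the running time, the initial state, and a final measurement in an arbitrary orthonormal basis
(the computational basis after a unitary `post`) with classical postprocessing `out`. All of these
are independent of the black-box input. -/
structure ContinuousQueryAlgorithm (N : ℕ) (W : Type) [Fintype W] [DecidableEq W]
    (Y : Type) where
  HD : QOp N W
  hermitian : HD.IsHermitian
  time : ℝ
  time_nonneg : 0 ≤ time
  init : QState N W
  norm_init : ‖init‖ = 1
  post : Matrix.unitaryGroup (QIndex N W) ℂ
  out : QIndex N W → Y

/-- The algorithm computes the (partial) function `f` on the domain `D` with error probability at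
most `1/3`. -/
def ContinuousQueryAlgorithm.Computes {N : ℕ} {W : Type} [Fintype W] [DecidableEq W] {Y : Type}
    (P : ContinuousQueryAlgorithm N W Y) (D : Set (Fin N → Bool)) (f : (Fin N → Bool) → Y) :
    Prop :=
  ∀ x ∈ D, 2 / 3 ≤ outcomeProb
    (applyOp ((P.post : QOp N W) * continuousEvolution P.HD P.time x) P.init) P.out (f x)

/-- Some algorithm making `q` queries in the conventional discrete-time model (with arbitrary
finite workspace) computes the partial function `f` on the domain `D` with error probability at
most `1/3`. -/
def DiscreteComputable {N : ℕ} {Y : Type} (q : ℕ) (D : Set (Fin N → Bool))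
    (f : (Fin N → Bool) → Y) : Prop :=
  ∃ (V : Type) (_ : Fintype V) (_ : DecidableEq V)
    (U : ℕ → Matrix.unitaryGroup (QIndex N V) ℂ) (init : QState N V) (out : QIndex N V → Y),
    ‖init‖ = 1 ∧ ∀ x ∈ D, 2 / 3 ≤ outcomeProb (applyOp (discreteRun U x q) init) out (f x)

/-- With `q` queries in the conventional discrete-time model one can simulate the evolution
`exp (-i (H_D + H_Q) t)`, for every input `x` and every initial state `ψ`, with error at most `ε`
in norm, using an ancilla register that starts in a basis state and is returned to it. -/
def DiscreteSimulable {N : ℕ} {W : Type} [Fintype W] [DecidableEq W]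
    (HD : QOp N W) (t ε : ℝ) (q : ℕ) : Prop :=
  ∃ (A : Type) (_ : Fintype A) (_ : DecidableEq A) (a : A)
    (U : ℕ → Matrix.unitaryGroup (QIndex N (W × A)) ℂ),
    ∀ (x : Fin N → Bool) (ψ : QState N W), ‖ψ‖ = 1 →
      ‖applyOp (discreteRun U x q) (attach a ψ)
        - attach a (applyOp (continuousEvolution HD t x) ψ)‖ ≤ ε

end

/-! The algorithm is built from Gram matrices. Two families of vectors are related by one
input-independent unitary exactly when their Gram matrices agree (`exists_unitary_applyOp_eq`), so
only the change of inner products caused by queries, the defect `⟪u, u'⟫ - ⟪O u, O' u'⟫`, has to be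
accounted for. A catalyst is a family of vectors whose defects sum to the difference between the
initial and the final Gram matrix. If its squared norm is at most `κ`, then `K` queries perform the
conversion with error `2 √(κ / K)`: spread `1 / √K` times the catalyst next to a slowly shifting
superposition of source and target (`exists_discreteRun_of_catalyst`).

It remains to find a catalyst with `κ = O(1 + ‖H_D‖ t)`. By the product formula the evolution is a
limit of `(exp (-iδO) V) ^ n` with `V = exp (-iδH_D)` and `δ = t / n`. In the frame rotating with
`exp (ikδO)` the query Hamiltonian disappears, and each step changes the Gram matrix only through `V
- 1`, of norm about `‖H_D‖ t / n`. The steps telescope to a cost `O(1 + ‖H_D‖ t)` independent of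
`n`. Leaving the rotating frame costs `O(1)` however large `t` is, because `O ^ 2 = 1`
(`exists_catalyst`). Finally `‖H_D‖ ≤ ‖abs H_D‖`.

For (2), three copies of the final state are generated at once and a majority vote absorbs the
simulation error. -/

noncomputable section

/-! ### Catalysts for alternating products of reflections' rotations and a unitary -/

section Reflections

open scoped InnerProductSpace

variable {E : Type*} [NormedAddCommGroup E] [InnerProductSpace ℂ E]

/-- The change of the inner product of `u` and `u'` when `O` is applied to the first and `O'` to
the second vector. -/
def innerDefect (O O' : E →L[ℂ] E) (u u' : E) : ℂ := ⟪u, u'⟫_ℂ - ⟪O u, O' u'⟫_ℂ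

/-- `exp (-i θ O)` for a reflection `O`. -/
def reflRot (O : E →L[ℂ] E) (θ : ℝ) : E →L[ℂ] E :=
  (Real.cos θ : ℂ) • 1 - (Complex.I * (Real.sin θ : ℂ)) • O

/-- The operator `sin θ • (sin θ - i cos θ O)`, which expresses the inner products of the vectors
`reflRot O (-θ) u` through `innerDefect`. -/
def reflRotDefect (O : E →L[ℂ] E) (θ : ℝ) : E →L[ℂ] E :=
  ((Real.sin θ : ℂ) ^ 2) • 1 - (Complex.I * (Real.sin θ : ℂ) * (Real.cos θ : ℂ)) • O

lemma reflRot_apply (O : E →L[ℂ] E) (θ : ℝ) (u : E) :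
    reflRot O θ u = (Real.cos θ : ℂ) • u - (Complex.I * (Real.sin θ : ℂ)) • O u := by
  simp [reflRot]

lemma reflRotDefect_apply (O : E →L[ℂ] E) (θ : ℝ) (u : E) :
    reflRotDefect O θ u = ((Real.sin θ : ℂ) ^ 2) • u
      - (Complex.I * (Real.sin θ : ℂ) * (Real.cos θ : ℂ)) • O u := by
  simp [reflRotDefect]

lemma reflRot_zero (O : E →L[ℂ] E) : reflRot O 0 = 1 := by
  simp [reflRot]

lemma reflRot_add_apply {O : E →L[ℂ] E} (hO : ∀ u, O (O u) = u) (θ φ : ℝ) (u : E) :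
    reflRot O (θ + φ) u = reflRot O θ (reflRot O φ u) := by
  simp only [reflRot_apply, map_sub, map_smul, hO, Real.cos_add, Real.sin_add]
  push_cast
  match_scalars
  · linear_combination (-(Complex.sin θ * Complex.sin φ)) * Complex.I_sq
  · ring

/-- As `O ^ 2 = 1`, the cross terms `⟪O z, z'⟫ - ⟪z, O' z'⟫` are themselves the defect of `O z` and
`z'`. A rotation by any angle thus costs a defect of bounded vectors. -/
lemma inner_reflRot_neg_left {O O' : E →L[ℂ] E} (hO : ∀ u, O (O u) = u) (θ : ℝ) (z z' : E) :
    ⟪reflRot O (-θ) z, reflRot O' (-θ) z'⟫_ℂ - ⟪z, z'⟫_ℂ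
      = -innerDefect O O' (reflRotDefect O θ z) z' := by
  have h1 : (Real.cos θ : ℂ) ^ 2 = 1 - (Real.sin θ : ℂ) ^ 2 := by
    rw [← Complex.ofReal_pow, Real.cos_sq']; push_cast; ring
  simp only [innerDefect, reflRot_apply, reflRotDefect_apply, map_sub, map_smul, hO,
    inner_sub_left, inner_sub_right, inner_smul_left, inner_smul_right, Real.cos_neg,
    Real.sin_neg, map_mul, map_pow, map_neg, Complex.conj_I, Complex.conj_ofReal, Complex.ofReal_neg]
  ring_nf
  rw [Complex.I_sq, h1]
  ring

lemma inner_reflRot_neg_right {O O' : E →L[ℂ] E} (hO' : ∀ u, O' (O' u) = u) (θ : ℝ) (z z' : E) :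
    ⟪reflRot O (-θ) z, reflRot O' (-θ) z'⟫_ℂ - ⟪z, z'⟫_ℂ
      = -innerDefect O O' z (reflRotDefect O' θ z') := by
  have h1 : (Real.cos θ : ℂ) ^ 2 = 1 - (Real.sin θ : ℂ) ^ 2 := by
    rw [← Complex.ofReal_pow, Real.cos_sq']; push_cast; ring
  simp only [innerDefect, reflRot_apply, reflRotDefect_apply, map_sub, map_smul, hO',
    inner_sub_left, inner_sub_right, inner_smul_left, inner_smul_right, Real.cos_neg,
    Real.sin_neg, map_mul, map_neg, Complex.conj_I, Complex.conj_ofReal, Complex.ofReal_neg]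
  ring_nf
  rw [Complex.I_sq, h1]
  ring

lemma norm_reflRot {O : E →L[ℂ] E} (hO : ∀ u, O (O u) = u)
    (hi : ∀ u v, ⟪O u, O v⟫_ℂ = ⟪u, v⟫_ℂ) (θ : ℝ) (z : E) : ‖reflRot O θ z‖ = ‖z‖ := by
  have h := inner_reflRot_neg_left (O' := O) hO (-θ) z z
  simp only [innerDefect, hi, neg_neg, sub_self, neg_zero, sub_eq_zero] at h
  rw [inner_self_eq_norm_sq_to_K, inner_self_eq_norm_sq_to_K] at h
  have h2 : ‖reflRot O θ z‖ ^ 2 = ‖z‖ ^ 2 := by exact_mod_cast h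
  exact (pow_left_inj₀ (norm_nonneg _) (norm_nonneg _) two_ne_zero).1 h2

lemma norm_reflRotDefect_le {O : E →L[ℂ] E} (hn : ∀ u, ‖O u‖ = ‖u‖) (θ : ℝ) (z : E) :
    ‖reflRotDefect O θ z‖ ≤ 2 * ‖z‖ := by
  rw [reflRotDefect_apply]
  refine (norm_sub_le _ _).trans ?_
  simp only [norm_smul, hn, norm_mul, norm_pow, Complex.norm_I, Complex.norm_real, one_mul,
    Real.norm_eq_abs]
  have hs := Real.abs_sin_le_one θ
  have hc := Real.abs_cos_le_one θ
  have h1 : |Real.sin θ| ^ 2 ≤ 1 := pow_le_one₀ (abs_nonneg _) hs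
  have h2 : |Real.sin θ| * |Real.cos θ| ≤ 1 := mul_le_one₀ hs (abs_nonneg _) hc
  nlinarith [norm_nonneg z]

/-- Applying a unitary `V` changes the inner product of vectors in the rotating frame by a
sum of defects with a factor `V - 1` in each term. -/
lemma inner_reflRot_neg_sub_inner_reflRot_neg {O O' : E →L[ℂ] E} (hO : ∀ u, O (O u) = u)
    (hO' : ∀ u, O' (O' u) = u) {V : E →L[ℂ] E} (hV : ∀ u v, ⟪V u, V v⟫_ℂ = ⟪u, v⟫_ℂ)
    (θ : ℝ) (z z' : E) :
    ⟪reflRot O (-θ) z, reflRot O' (-θ) z'⟫_ℂ - ⟪reflRot O (-θ) (V z), reflRot O' (-θ) (V z')⟫_ℂ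
      = innerDefect O O' (V z - z) (reflRotDefect O' θ ((1 / 2 : ℂ) • (V z' + z')))
        + innerDefect O O' (reflRotDefect O θ ((1 / 2 : ℂ) • (V z + z))) (V z' - z') := by
  -- Symmetrized difference: with `V` unitary, `⟪V z - z, (V z' + z') / 2⟫ + ⟪(V z + z) / 2, V z' -
  -- z'⟫` vanishes, so only the defects survive.
  have h1 := inner_reflRot_neg_right (O := O) hO' θ (V z - z) ((1 / 2 : ℂ) • (V z' + z'))
  have h2 := inner_reflRot_neg_left (O' := O') hO θ ((1 / 2 : ℂ) • (V z + z)) (V z' - z')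
  rw [eq_neg_iff_add_eq_zero, add_comm, ← eq_neg_iff_add_eq_zero] at h1 h2
  rw [h1, h2]
  simp only [map_sub, map_smul, map_add, inner_sub_left, inner_sub_right, inner_smul_left,
    inner_smul_right, inner_add_left, inner_add_right, hV]
  have : (starRingEnd ℂ) (1 / 2) = 1 / 2 := by rw [map_div₀, map_one, map_ofNat]
  rw [this]
  ring

/-- Polarization: two vectors whose defects add up to the symmetrized defect of `a` and `b`. -/
def polarPair (O : E →L[ℂ] E) (r : ℝ) (a b : E) (i : Bool) : E :=
  if i then (r : ℂ)⁻¹ • a + ((r : ℂ) / 2) • b else O ((r : ℂ)⁻¹ • a - ((r : ℂ) / 2) • b)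

/-- Applying `O` and `O'` flips the sign of a defect, so the pair yields the difference of the
defects of `a / r + r b / 2` and `a / r - r b / 2`, in which only the cross terms remain. The free
parameter `r` balances the norms of `a` and `b`. -/
lemma sum_innerDefect_polarPair {O O' : E →L[ℂ] E} (hO : ∀ u, O (O u) = u)
    (hO' : ∀ u, O' (O' u) = u) {r : ℝ} (hr : 0 < r) (a b a' b' : E) :
    ∑ i, innerDefect O O' (polarPair O r a b i) (polarPair O' r a' b' i)
      = innerDefect O O' a b' + innerDefect O O' b a' := by
  have hr' : (r : ℂ) ≠ 0 := by exact_mod_cast hr.ne'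
  simp only [Fintype.sum_bool, polarPair, if_true, Bool.false_eq_true, if_false, innerDefect, hO,
    hO', map_sub, map_add, map_smul, inner_sub_left, inner_sub_right, inner_smul_left,
    inner_smul_right, inner_add_left, inner_add_right, map_inv₀, map_div₀, Complex.conj_ofReal,
    map_ofNat]
  field_simp
  ring

lemma sum_norm_sq_polarPair_le {O : E →L[ℂ] E} (hn : ∀ u, ‖O u‖ = ‖u‖) {r A B : ℝ} (hr : 0 < r)
    {a b : E} (ha : ‖a‖ ≤ A) (hb : ‖b‖ ≤ B) :
    ∑ i, ‖polarPair O r a b i‖ ^ 2 ≤ 2 * (r ^ 2)⁻¹ * A ^ 2 + r ^ 2 / 2 * B ^ 2 := by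
  simp only [Fintype.sum_bool, polarPair, if_true, Bool.false_eq_true, if_false, hn]
  have h := parallelogram_law_with_norm ℂ ((r : ℂ)⁻¹ • a) (((r : ℂ) / 2) • b)
  have e1 : ‖(r : ℂ)⁻¹ • a‖ = r⁻¹ * ‖a‖ := by
    rw [norm_smul, norm_inv, Complex.norm_real, Real.norm_of_nonneg hr.le]
  have e2 : ‖((r : ℂ) / 2) • b‖ = r / 2 * ‖b‖ := by
    rw [norm_smul, norm_div, Complex.norm_real, Real.norm_of_nonneg hr.le]; simp
  rw [e1, e2] at h
  have e3 : ‖a‖ ^ 2 ≤ A ^ 2 := pow_le_pow_left₀ (norm_nonneg _) ha 2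
  have e4 : ‖b‖ ^ 2 ≤ B ^ 2 := pow_le_pow_left₀ (norm_nonneg _) hb 2
  calc _ = 2 * (r ^ 2)⁻¹ * ‖a‖ ^ 2 + r ^ 2 / 2 * ‖b‖ ^ 2 := by
        rw [h]; field_simp
    _ ≤ _ := by gcongr

/-- The catalyst for the alternating product of rotations by reflections and a unitary `V`: its
size is governed by the distance of `V` from the identity. -/
theorem exists_catalyst {S : Type*} (O : S → E →L[ℂ] E) (hO : ∀ s u, O s (O s u) = u)
    (hi : ∀ s u v, ⟪O s u, O s v⟫_ℂ = ⟪u, v⟫_ℂ) (V : E →L[ℂ] E)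
    (hV : ∀ u v, ⟪V u, V v⟫_ℂ = ⟪u, v⟫_ℂ) {d : ℝ} (hd : 0 < d)
    (hVd : ∀ u, ‖V u - u‖ ≤ d * ‖u‖) (δ : ℝ) (n : ℕ) :
    ∃ f : S → E → Option (Fin n) × Bool → E,
      (∀ s s' ψ ψ', ⟪ψ, ψ'⟫_ℂ - ⟪((reflRot (O s) δ * V) ^ n) ψ, ((reflRot (O s') δ * V) ^ n) ψ'⟫_ℂ
        = ∑ v, innerDefect (O s) (O s') (f s ψ v) (f s' ψ' v)) ∧
      ∀ s ψ, ∑ v, ‖f s ψ v‖ ^ 2 ≤ (4 * (n * d) + 3) * ‖ψ‖ ^ 2 := by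
  set z : S → E → ℕ → E := fun s ψ k => ((reflRot (O s) δ * V) ^ k) ψ with hz
  have hOn : ∀ s u, ‖O s u‖ = ‖u‖ := fun s => (LinearMap.norm_map_iff_inner_map_map (O s)).2 (hi s)
  have hVn : ∀ u, ‖V u‖ = ‖u‖ := (LinearMap.norm_map_iff_inner_map_map V).2 hV
  have hz0 : ∀ s ψ, z s ψ 0 = ψ := fun s ψ => by simp [hz]
  have hzs : ∀ s ψ k, z s ψ (k + 1) = reflRot (O s) δ (V (z s ψ k)) := fun s ψ k => by
    simp only [hz, pow_succ']
    rfl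
  have hzn : ∀ s ψ k, ‖z s ψ k‖ = ‖ψ‖ := by
    intro s ψ k
    induction k with
    | zero => rw [hz0]
    | succ k ih => rw [hzs, norm_reflRot (hO s) (hi s), hVn, ih]
  let m : S → E → ℕ → E := fun s ψ k =>
    reflRotDefect (O s) (k * δ) ((1 / 2 : ℂ) • (V (z s ψ k) + z s ψ k))
  -- `some k` pays for the `k`-th application of `V`, `none` for leaving the rotating frame at the
  -- end. As `V z - z` has size `d` and `m` has size `O(1)`, the balanced choice `r = √d` gives
  -- squared norm `O(d)`.
  let f : S → E → Option (Fin n) × Bool → E := fun s ψ v => match v.1 with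
    | none => polarPair (O s) 1 ((-1 / 2 : ℂ) • z s ψ n) (reflRotDefect (O s) (n * δ) (z s ψ n)) v.2
    | some k => polarPair (O s) (Real.sqrt d) (V (z s ψ k) - z s ψ k) (m s ψ k) v.2
  have hsq : 0 < Real.sqrt d := Real.sqrt_pos.2 hd
  refine ⟨f, fun s s' ψ ψ' => ?_, fun s ψ => ?_⟩
  · rw [Fintype.sum_prod_type, Fintype.sum_option]
    simp only [f]
    rw [sum_innerDefect_polarPair (hO s) (hO s') one_pos]
    simp_rw [sum_innerDefect_polarPair (hO s) (hO s') hsq]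
    -- The Gram matrix in the rotating frame, whose increments telescope.
    let F : ℕ → ℂ := fun k => ⟪reflRot (O s) (-(k * δ)) (z s ψ k),
      reflRot (O s') (-(k * δ)) (z s' ψ' k)⟫_ℂ
    have hF : ∀ k, F k - F (k + 1) = innerDefect (O s) (O s') (V (z s ψ k) - z s ψ k) (m s' ψ' k)
        + innerDefect (O s) (O s') (m s ψ k) (V (z s' ψ' k) - z s' ψ' k) := by
      intro k
      have hr : ∀ s ψ, reflRot (O s) (-((k + 1 : ℕ) * δ)) (z s ψ (k + 1))
          = reflRot (O s) (-(k * δ)) (V (z s ψ k)) := by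
        intro s ψ
        rw [hzs, ← reflRot_add_apply (hO s)]
        congr 2
        push_cast
        ring
      simp only [F]
      rw [hr, hr, inner_reflRot_neg_sub_inner_reflRot_neg (hO s) (hO s') hV]
    have hsum : ∑ k : Fin n, (innerDefect (O s) (O s') (V (z s ψ k) - z s ψ k) (m s' ψ' k)
        + innerDefect (O s) (O s') (m s ψ k) (V (z s' ψ' k) - z s' ψ' k)) = F 0 - F n := by
      rw [← Finset.sum_range_sub', ← Fin.sum_univ_eq_sum_range (fun k => F k - F (k + 1))]
      exact Finset.sum_congr rfl fun k _ => (hF k).symm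
    rw [hsum]
    have hF0 : F 0 = ⟪ψ, ψ'⟫_ℂ := by simp [F, hz0, reflRot_zero]
    -- The two expressions for the same change of frame are averaged to obtain the symmetrized form
    -- needed for polarization.
    have h1 := inner_reflRot_neg_right (O := O s) (hO s') (n * δ) (z s ψ n) (z s' ψ' n)
    have h2 := inner_reflRot_neg_left (O' := O s') (hO s) (n * δ) (z s ψ n) (z s' ψ' n)
    have e1 : innerDefect (O s) (O s') ((-1 / 2 : ℂ) • z s ψ n)
        (reflRotDefect (O s') (n * δ) (z s' ψ' n)) = (1 / 2) * (F n - ⟪z s ψ n, z s' ψ' n⟫_ℂ) := by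
      simp only [F]
      rw [h1]
      have : (starRingEnd ℂ) (-1 / 2) = -1 / 2 := by rw [map_div₀, map_neg, map_one, map_ofNat]
      simp only [innerDefect, map_smul, inner_smul_left, this]
      ring
    have e2 : innerDefect (O s) (O s') (reflRotDefect (O s) (n * δ) (z s ψ n))
        ((-1 / 2 : ℂ) • z s' ψ' n) = (1 / 2) * (F n - ⟪z s ψ n, z s' ψ' n⟫_ℂ) := by
      simp only [F]
      rw [h2]
      simp only [innerDefect, map_smul, inner_smul_right]
      ring
    rw [e1, e2, hF0]
    ring
  · rw [Fintype.sum_prod_type, Fintype.sum_option]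
    simp only [f]
    have hb : ∀ k, ‖m s ψ k‖ ≤ 2 * ‖ψ‖ := by
      intro k
      refine (norm_reflRotDefect_le (hOn s) _ _).trans ?_
      gcongr
      rw [norm_smul]
      have := norm_add_le (V (z s ψ k)) (z s ψ k)
      rw [hVn, hzn] at this
      norm_num
      linarith
    have ha : ∀ k, ‖V (z s ψ k) - z s ψ k‖ ≤ d * ‖ψ‖ := fun k => by
      simpa only [hzn] using hVd (z s ψ k)
    have h1 : ∑ i, ‖polarPair (O s) 1 ((-1 / 2 : ℂ) • z s ψ n)
        (reflRotDefect (O s) (n * δ) (z s ψ n)) i‖ ^ 2 ≤ 3 * ‖ψ‖ ^ 2 := by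
      refine (sum_norm_sq_polarPair_le (A := 1 / 2 * ‖ψ‖) (B := 2 * ‖ψ‖) (hOn s) one_pos ?_ ?_).trans ?_
      · rw [norm_smul, hzn]; norm_num
      · simpa only [hzn] using norm_reflRotDefect_le (hOn s) (n * δ) (z s ψ n)
      · nlinarith [sq_nonneg ‖ψ‖]
    have h2 : ∀ k : Fin n, ∑ i, ‖polarPair (O s) (Real.sqrt d) (V (z s ψ k) - z s ψ k)
        (m s ψ k) i‖ ^ 2 ≤ 4 * d * ‖ψ‖ ^ 2 := by
      intro k
      refine (sum_norm_sq_polarPair_le (hOn s) hsq (ha k) (hb k)).trans (le_of_eq ?_)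
      rw [Real.sq_sqrt hd.le]
      field_simp
      ring
    calc _ ≤ 3 * ‖ψ‖ ^ 2 + ∑ _k : Fin n, 4 * d * ‖ψ‖ ^ 2 :=
          add_le_add h1 (Finset.sum_le_sum fun k _ => h2 k)
      _ = _ := by simp; ring

end Reflections

/-! ### Product formula for contractions -/

section ProductFormula

open Filter Topology

lemma norm_pow_mul_le_of_norm_le_one {A : Type*} [NormedRing A] {a : A} (ha : ‖a‖ ≤ 1) (c : A)
    (n : ℕ) : ‖a ^ n * c‖ ≤ ‖c‖ := by
  induction n with
  | zero => simp
  | succ n ih =>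
    rw [pow_succ', mul_assoc]
    exact (norm_mul_le _ _).trans ((mul_le_of_le_one_left (norm_nonneg _) ha).trans ih)

lemma norm_pow_sub_pow_le_of_norm_le_one {A : Type*} [NormedRing A] {a b : A} (ha : ‖a‖ ≤ 1)
    (hb : ‖b‖ ≤ 1) (n : ℕ) : ‖a ^ n - b ^ n‖ ≤ n * ‖a - b‖ := by
  induction n with
  | zero => simp
  | succ n ih =>
    have h : a ^ (n + 1) - b ^ (n + 1) = a ^ n * (a - b) + (a ^ n - b ^ n) * b := by
      rw [pow_succ, pow_succ]; noncomm_ring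
    rw [h]
    refine (norm_add_le _ _).trans ?_
    have h1 := norm_pow_mul_le_of_norm_le_one ha (a - b) n
    have h2 : ‖(a ^ n - b ^ n) * b‖ ≤ ‖a ^ n - b ^ n‖ :=
      (norm_mul_le _ _).trans (mul_le_of_le_one_right (norm_nonneg _) hb)
    push_cast
    linarith

lemma HasDerivAt.tendsto_nat_smul_sub {F : Type*} [NormedAddCommGroup F] [NormedSpace ℝ F]
    {D : ℝ → F} {D' : F} (h : HasDerivAt D D' 0) (t : ℝ) :
    Tendsto (fun n : ℕ => (n : ℝ) • (D (t / n) - D 0)) atTop (𝓝 (t • D')) := by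
  have h1 : HasDerivAt (fun s : ℝ => t * s) t 0 := by
    simpa using (hasDerivAt_id (0 : ℝ)).const_mul t
  have h2 : HasDerivAt (fun s : ℝ => D (t * s)) (t • D') 0 :=
    HasDerivAt.scomp (h := fun s => t * s) 0 (by simpa using h) h1
  have h3 : Tendsto (fun n : ℕ => ((n : ℝ))⁻¹) atTop (𝓝[≠] 0) :=
    tendsto_nhdsWithin_iff.2 ⟨tendsto_inv_atTop_nhds_zero_nat, by
      filter_upwards [eventually_gt_atTop 0] with n hn
      simpa using hn.ne'⟩
  refine (h2.tendsto_slope_zero.comp h3).congr fun n => ?_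
  simp [div_eq_mul_inv]

/-- The product formula for a path of contractions through the identity. -/
theorem tendsto_pow_div_exp {A : Type*} [NormedRing A] [NormedAlgebra ℝ A] [CompleteSpace A]
    {G : ℝ → A} {X : A} (hG0 : G 0 = 1) (hG : HasDerivAt G X 0)
    (hn : ∀ δ, ‖G δ‖ ≤ 1) (hX : ∀ δ : ℝ, ‖NormedSpace.exp (δ • X)‖ ≤ 1) (t : ℝ) :
    Tendsto (fun n : ℕ => G (t / n) ^ n) atTop (𝓝 (NormedSpace.exp (t • X))) := by
  let +nondep : NormedAlgebra ℚ A := .restrictScalars ℚ ℝ A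
  have hE : HasDerivAt (fun δ : ℝ => NormedSpace.exp (δ • X)) X 0 := by
    simpa using hasDerivAt_exp_smul_const (𝕂 := ℝ) X (0 : ℝ)
  -- Both paths have the same value and derivative at `0`, so `n` times their distance at `t / n`
  -- tends to `0`. For contractions this bounds the distance of the `n`-th powers.
  have hD := (hG.sub hE).tendsto_nat_smul_sub t
  have hD' : Tendsto (fun n : ℕ => (n : ℝ) * ‖G (t / n) - NormedSpace.exp ((t / n) • X)‖) atTop
      (𝓝 0) := by
    have := hD.norm
    simpa [hG0, norm_smul] using this
  rw [tendsto_iff_norm_sub_tendsto_zero]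
  refine squeeze_zero' (Eventually.of_forall fun n => norm_nonneg _) ?_ hD'
  filter_upwards [eventually_gt_atTop 0] with n hn0
  have hn0' : (n : ℝ) ≠ 0 := by exact_mod_cast hn0.ne'
  have h1 : NormedSpace.exp (t • X) = NormedSpace.exp ((t / n) • X) ^ n := by
    rw [← NormedSpace.exp_nsmul, ← Nat.cast_smul_eq_nsmul ℝ, smul_smul, mul_div_cancel₀ _ hn0']
  rw [h1]
  exact norm_pow_sub_pow_le_of_norm_le_one (hn _) (hX _) n

end ProductFormula

/-! ### Unitary flows and catalysts for the continuous evolution -/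

section Evolution

open Filter Topology
open scoped InnerProductSpace

variable {E : Type*} [NormedAddCommGroup E] [InnerProductSpace ℂ E] [CompleteSpace E]

/-- The unitary group `exp (-i δ H)` generated by `H`. -/
def unitaryFlow (H : E →L[ℂ] E) (δ : ℝ) : E →L[ℂ] E :=
  NormedSpace.exp ((-(Complex.I * (δ : ℂ))) • H)

lemma unitaryFlow_eq (H : E →L[ℂ] E) (δ : ℝ) :
    unitaryFlow H δ = NormedSpace.exp (δ • ((-Complex.I) • H)) := by
  rw [unitaryFlow, ← Complex.coe_smul δ, smul_smul]
  congr 2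
  ring

lemma inner_unitaryFlow {H : E →L[ℂ] E} (hH : IsSelfAdjoint H) (δ : ℝ) (u v : E) :
    ⟪unitaryFlow H δ u, unitaryFlow H δ v⟫_ℂ = ⟪u, v⟫_ℂ := by
  have hs : (-δ : ℝ) • H ∈ selfAdjoint (E →L[ℂ] E) := (IsSelfAdjoint.all (-δ)).smul hH
  have h : unitaryFlow H δ = selfAdjoint.expUnitary ⟨(-δ : ℝ) • H, hs⟩ := by
    rw [selfAdjoint.expUnitary_coe, unitaryFlow]
    dsimp only
    rw [← Complex.coe_smul (-δ), smul_smul]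
    congr 2
    push_cast
    ring
  rw [h]
  exact ContinuousLinearMap.inner_map_map_of_mem_unitary (SetLike.coe_mem _) u v

lemma norm_unitaryFlow {H : E →L[ℂ] E} (hH : IsSelfAdjoint H) (δ : ℝ) (u : E) :
    ‖unitaryFlow H δ u‖ = ‖u‖ :=
  (LinearMap.norm_map_iff_inner_map_map _).2 (inner_unitaryFlow hH δ) u

lemma norm_unitaryFlow_le_one {H : E →L[ℂ] E} (hH : IsSelfAdjoint H) (δ : ℝ) :
    ‖unitaryFlow H δ‖ ≤ 1 :=
  ContinuousLinearMap.opNorm_le_bound _ zero_le_one fun u => by rw [norm_unitaryFlow hH, one_mul]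

lemma hasDerivAt_unitaryFlow (H : E →L[ℂ] E) :
    HasDerivAt (unitaryFlow H) ((-Complex.I) • H) 0 := by
  have h : unitaryFlow H = fun δ : ℝ => NormedSpace.exp (δ • ((-Complex.I) • H)) :=
    funext (unitaryFlow_eq H)
  rw [h]
  simpa using hasDerivAt_exp_smul_const (𝕂 := ℝ) ((-Complex.I) • H) (0 : ℝ)

lemma unitaryFlow_zero (H : E →L[ℂ] E) : unitaryFlow H 0 = 1 := by
  simp [unitaryFlow]

omit [CompleteSpace E] in
lemma hasDerivAt_reflRot (O : E →L[ℂ] E) : HasDerivAt (reflRot O) ((-Complex.I) • O) 0 := by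
  have hc : HasDerivAt (fun θ : ℝ => (Real.cos θ : ℂ)) 0 0 := by
    simpa using (Real.hasDerivAt_cos 0).ofReal_comp
  have hs : HasDerivAt (fun θ : ℝ => (Real.sin θ : ℂ)) 1 0 := by
    simpa using (Real.hasDerivAt_sin 0).ofReal_comp
  have h := (hc.smul_const (1 : E →L[ℂ] E)).sub ((hs.const_mul Complex.I).smul_const O)
  have e : ((0 : ℂ) • (1 : E →L[ℂ] E) - (Complex.I * 1) • O) = (-Complex.I) • O := by simp
  rw [e] at h
  exact h

lemma isSelfAdjoint_of_reflection {O : E →L[ℂ] E} (hO : ∀ u, O (O u) = u)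
    (hi : ∀ u v, ⟪O u, O v⟫_ℂ = ⟪u, v⟫_ℂ) : IsSelfAdjoint O := by
  rw [ContinuousLinearMap.isSelfAdjoint_iff_isSymmetric]
  intro u v
  have := hi u (O v)
  rw [hO] at this
  exact this

theorem tendsto_reflRot_mul_unitaryFlow_pow {O H : E →L[ℂ] E} (hO : ∀ u, O (O u) = u)
    (hi : ∀ u v, ⟪O u, O v⟫_ℂ = ⟪u, v⟫_ℂ) (hH : IsSelfAdjoint H) (t : ℝ) :
    Tendsto (fun n : ℕ => (reflRot O (t / n) * unitaryFlow H (t / n)) ^ n) atTop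
      (𝓝 (unitaryFlow (H + O) t)) := by
  have hOs := isSelfAdjoint_of_reflection hO hi
  have hd := (hasDerivAt_reflRot O).mul (hasDerivAt_unitaryFlow H)
  rw [reflRot_zero, unitaryFlow_zero, one_mul, mul_one, ← smul_add, add_comm] at hd
  rw [unitaryFlow_eq]
  refine tendsto_pow_div_exp (G := fun δ => reflRot O δ * unitaryFlow H δ)
    (by simp [reflRot_zero, unitaryFlow_zero]) hd (fun δ => ?_) (fun δ => ?_) t
  · refine ContinuousLinearMap.opNorm_le_bound _ zero_le_one fun u => ?_
    rw [show (reflRot O δ * unitaryFlow H δ) u = reflRot O δ (unitaryFlow H δ u) from rfl,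
      norm_reflRot hO hi, norm_unitaryFlow hH, one_mul]
  · rw [← unitaryFlow_eq]
    exact norm_unitaryFlow_le_one (hH.add hOs) δ

/-- For a finite family of reflections, the evolutions `exp (-i (H + O s) t)` are approximated by
linear isometries that have a catalyst of squared norm `O(1 + ‖H‖ t)`. -/
theorem exists_catalyst_evolution {S : Type*} [Finite S] (O : S → E →L[ℂ] E)
    (hO : ∀ s u, O s (O s u) = u) (hi : ∀ s u v, ⟪O s u, O s v⟫_ℂ = ⟪u, v⟫_ℂ)
    {H : E →L[ℂ] E} (hH : IsSelfAdjoint H) {t Λ ε : ℝ} (ht : 0 ≤ t) (hΛ : ‖H‖ ≤ Λ) (hε : 0 < ε) :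
    ∃ (n : ℕ) (Z : S → E →L[ℂ] E) (f : S → E → Option (Fin n) × Bool → E),
      (∀ s ψ, ‖Z s ψ‖ = ‖ψ‖) ∧ (∀ s ψ, ‖Z s ψ - unitaryFlow (H + O s) t ψ‖ ≤ ε * ‖ψ‖) ∧
      (∀ s s' ψ ψ', ⟪ψ, ψ'⟫_ℂ - ⟪Z s ψ, Z s' ψ'⟫_ℂ
        = ∑ v, innerDefect (O s) (O s') (f s ψ v) (f s' ψ' v)) ∧
      ∀ s ψ, ∑ v, ‖f s ψ v‖ ^ 2 ≤ 7 * (1 + Λ * t) * ‖ψ‖ ^ 2 := by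
  -- Finiteness of `S` provides one `n` for all inputs.
  have h1 : ∀ᶠ n : ℕ in atTop, ∀ s,
      ‖(reflRot (O s) (t / n) * unitaryFlow H (t / n)) ^ n - unitaryFlow (H + O s) t‖ < ε := by
    rw [eventually_all]
    intro s
    have := (tendsto_iff_norm_sub_tendsto_zero.1
      (tendsto_reflRot_mul_unitaryFlow_pow (hO s) (hi s) hH t))
    exact this.eventually_lt_const hε
  -- The limit is `‖H‖ t`. The extra `1` makes the inequality strict and keeps `d` positive.
  have h2 : ∀ᶠ n : ℕ in atTop, (n : ℝ) * ‖unitaryFlow H (t / n) - 1‖ < Λ * t + 1 := by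
    have := ((hasDerivAt_unitaryFlow H).tendsto_nat_smul_sub t).norm
    rw [unitaryFlow_zero] at this
    simp only [norm_smul, Real.norm_natCast, norm_neg, Complex.norm_I, one_mul,
      Real.norm_of_nonneg ht] at this
    refine this.eventually_lt_const ?_
    nlinarith
  obtain ⟨n, hn1, hn2, hn0⟩ := (h1.and (h2.and (eventually_gt_atTop 0))).exists
  have hn0' : (0 : ℝ) < n := by exact_mod_cast hn0
  have hΛ0 : 0 ≤ Λ := (norm_nonneg _).trans hΛ
  have hd : 0 < (Λ * t + 1) / n := by positivity
  obtain ⟨f, hf1, hf2⟩ := exists_catalyst O hO hi (unitaryFlow H (t / n))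
    (inner_unitaryFlow hH _) hd (fun u => by
      refine ((unitaryFlow H (t / n) - 1).le_opNorm u).trans ?_
      gcongr
      rw [le_div_iff₀ hn0', mul_comm]
      exact hn2.le) (t / n) n
  refine ⟨n, fun s => (reflRot (O s) (t / n) * unitaryFlow H (t / n)) ^ n, f, fun s ψ => ?_,
    fun s ψ => ?_, hf1, fun s ψ => (hf2 s ψ).trans ?_⟩
  · have h : ∀ k : ℕ, ‖((reflRot (O s) (t / n) * unitaryFlow H (t / n)) ^ k) ψ‖ = ‖ψ‖ := by
      intro k
      induction k with
      | zero => simp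
      | succ k ih =>
        rw [pow_succ', mul_assoc]
        change ‖reflRot (O s) _ (unitaryFlow H _ _)‖ = _
        rw [norm_reflRot (hO s) (hi s), norm_unitaryFlow hH]
        exact ih
    exact h n
  · refine (((reflRot (O s) (t / n) * unitaryFlow H (t / n)) ^ n
      - unitaryFlow (H + O s) t).le_opNorm ψ).trans ?_
    gcongr
    exact (hn1 s).le
  · gcongr
    rw [mul_div_cancel₀ _ hn0'.ne']
    nlinarith [mul_nonneg hΛ0 ht]

end Evolution

/-! ### Matrices acting on states, and equality of Gram matrices -/

open scoped InnerProductSpace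

lemma applyOp_eq {ι : Type} [Fintype ι] [DecidableEq ι] (M : Matrix ι ι ℂ)
    (ψ : EuclideanSpace ℂ ι) : applyOp M ψ = Matrix.toEuclideanCLM (n := ι) (𝕜 := ℂ) M ψ := rfl

lemma applyOp_mul {ι : Type} [Fintype ι] (M M' : Matrix ι ι ℂ) (ψ : EuclideanSpace ℂ ι) :
    applyOp (M * M') ψ = applyOp M (applyOp M' ψ) := by
  simp [applyOp, Matrix.mulVec_mulVec]

lemma inner_applyOp_unitary {ι : Type} [Fintype ι] [DecidableEq ι]
    (U : Matrix.unitaryGroup ι ℂ) (φ ψ : EuclideanSpace ℂ ι) :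
    ⟪applyOp (U : Matrix ι ι ℂ) φ, applyOp (U : Matrix ι ι ℂ) ψ⟫_ℂ = ⟪φ, ψ⟫_ℂ := by
  rw [applyOp_eq, applyOp_eq]
  exact ContinuousLinearMap.inner_map_map_of_mem_unitary
    (Unitary.map_mem (Matrix.toEuclideanCLM (n := ι) (𝕜 := ℂ)) U.2) φ ψ

lemma norm_applyOp_unitary {ι : Type} [Fintype ι] [DecidableEq ι]
    (U : Matrix.unitaryGroup ι ℂ) (ψ : EuclideanSpace ℂ ι) :
    ‖applyOp (U : Matrix ι ι ℂ) ψ‖ = ‖ψ‖ :=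
  (LinearMap.norm_map_iff_inner_map_map
    (Matrix.toEuclideanCLM (n := ι) (𝕜 := ℂ) (U : Matrix ι ι ℂ))).2 (inner_applyOp_unitary U) ψ

lemma norm_applyOp_unitary_sub {ι : Type} [Fintype ι] [DecidableEq ι]
    (U : Matrix.unitaryGroup ι ℂ) (φ ψ : EuclideanSpace ℂ ι) :
    ‖applyOp (U : Matrix ι ι ℂ) φ - applyOp (U : Matrix ι ι ℂ) ψ‖ = ‖φ - ψ‖ := by
  rw [← norm_applyOp_unitary U (φ - ψ), applyOp_eq, applyOp_eq, applyOp_eq, map_sub]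

/-- Two families of vectors with the same Gram matrix are related by a unitary. -/
theorem exists_unitary_applyOp_eq {ι : Type} [Fintype ι] [DecidableEq ι] {S : Type*}
    (f g : S → EuclideanSpace ℂ ι) (h : ∀ s s', ⟪f s, f s'⟫_ℂ = ⟪g s, g s'⟫_ℂ) :
    ∃ U : Matrix.unitaryGroup ι ℂ, ∀ s, applyOp (U : Matrix ι ι ℂ) (f s) = g s := by
  let F := Finsupp.linearCombination ℂ f
  let G := Finsupp.linearCombination ℂ g
  have hin : ∀ c c', ⟪F c, F c'⟫_ℂ = ⟪G c, G c'⟫_ℂ := by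
    intro c c'
    simp only [F, G, Finsupp.linearCombination_apply, Finsupp.sum_inner, Finsupp.inner_sum,
      inner_smul_left, inner_smul_right, h]
  have hnorm : ∀ c, ‖F c‖ = ‖G c‖ := by
    intro c
    rw [@norm_eq_sqrt_re_inner ℂ, @norm_eq_sqrt_re_inner ℂ, hin]
  -- Linear relations among the `f s` also hold among the `g s`, so `f s ↦ g s` is a well-defined
  -- isometry on the span. In finite dimension it extends to a unitary.
  have hker : LinearMap.ker F ≤ LinearMap.ker G := by
    intro c hc
    rw [LinearMap.mem_ker] at hc ⊢
    rw [← norm_eq_zero, ← hnorm, hc, norm_zero]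
  let T : LinearMap.range F →ₗ[ℂ] EuclideanSpace ℂ ι :=
    (LinearMap.ker F).liftQ G hker ∘ₗ (F.quotKerEquivRange.symm : _ →ₗ[ℂ] _)
  have hT : ∀ c, T ⟨F c, LinearMap.mem_range_self F c⟩ = G c := by
    intro c
    have : F.quotKerEquivRange.symm ⟨F c, LinearMap.mem_range_self F c⟩
        = Submodule.Quotient.mk c := by
      rw [LinearEquiv.symm_apply_eq]; rfl
    simp only [T, LinearMap.comp_apply, LinearEquiv.coe_coe, this]
    rfl
  let L : LinearMap.range F →ₗᵢ[ℂ] EuclideanSpace ℂ ι := ⟨T, by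
    rintro ⟨_, c, rfl⟩
    rw [hT]
    exact (hnorm c).symm⟩
  let M := L.extend.toContinuousLinearMap
  have hM : star M * M = 1 := by
    rw [ContinuousLinearMap.star_eq_adjoint]
    exact (ContinuousLinearMap.norm_map_iff_adjoint_comp_self M).1 fun x => L.extend.norm_map x
  refine ⟨⟨(Matrix.toEuclideanCLM (n := ι) (𝕜 := ℂ)).symm M, ?_⟩, fun s => ?_⟩
  · rw [Matrix.mem_unitaryGroup_iff']
    apply EquivLike.injective (Matrix.toEuclideanCLM (n := ι) (𝕜 := ℂ))
    rw [map_mul, map_star, StarAlgEquiv.apply_symm_apply, hM, map_one]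
  · rw [applyOp_eq]
    dsimp only
    rw [StarAlgEquiv.apply_symm_apply]
    have hs : f s = F (Finsupp.single s 1) := by simp [F]
    have hs' : g s = G (Finsupp.single s 1) := by simp [G]
    rw [hs, hs', ← hT]
    exact L.extend_apply ⟨F (Finsupp.single s 1), LinearMap.mem_range_self F _⟩

/-! ### Query gates and discrete runs -/

section Query

variable {N : ℕ} {W : Type} [Fintype W] [DecidableEq W]

/-- The query gate as an operator on states. -/
def queryCLM (W : Type) [Fintype W] [DecidableEq W] (x : Fin N → Bool) :
    QState N W →L[ℂ] QState N W :=
  Matrix.toEuclideanCLM (n := QIndex N W) (𝕜 := ℂ) (queryOp W x)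

lemma queryCLM_apply (x : Fin N → Bool) (ψ : QState N W) (p : QIndex N W) :
    queryCLM W x ψ p = ψ ((p.1.1, xor p.1.2 (x p.1.1)), p.2) := by
  obtain ⟨⟨i, b⟩, w⟩ := p
  change (queryOp W x).mulVec (WithLp.ofLp ψ) _ = _
  simp only [Matrix.mulVec, dotProduct, queryOp, Matrix.of_apply]
  rw [Fintype.sum_eq_single ((i, xor b (x i)), w)]
  · simp
  · rintro ⟨⟨i', b'⟩, w'⟩ h
    rw [if_neg, zero_mul]
    intro h'
    apply h
    simp only [Prod.mk.injEq] at h' ⊢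
    obtain ⟨⟨rfl, rfl⟩, rfl⟩ := h'
    simp

lemma queryCLM_queryCLM (x : Fin N → Bool) (ψ : QState N W) :
    queryCLM W x (queryCLM W x ψ) = ψ := by
  ext p
  simp [queryCLM_apply]

lemma inner_queryCLM (x : Fin N → Bool) (φ ψ : QState N W) :
    ⟪queryCLM W x φ, queryCLM W x ψ⟫_ℂ = ⟪φ, ψ⟫_ℂ := by
  simp only [PiLp.inner_apply, queryCLM_apply]
  refine Fintype.sum_equiv (Function.Involutive.toPerm
    (fun p : QIndex N W => ((p.1.1, xor p.1.2 (x p.1.1)), p.2)) fun p => by simp) _ _ fun p => rfl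

lemma norm_queryCLM_sub (x : Fin N → Bool) (φ ψ : QState N W) :
    ‖queryCLM W x φ - queryCLM W x ψ‖ = ‖φ - ψ‖ := by
  rw [← map_sub, (LinearMap.norm_map_iff_inner_map_map _).2 (inner_queryCLM x)]

lemma applyOp_discreteRun_succ (U : ℕ → Matrix.unitaryGroup (QIndex N W) ℂ) (x : Fin N → Bool)
    (q : ℕ) (ψ : QState N W) :
    applyOp (discreteRun U x (q + 1)) ψ
      = applyOp (U (q + 1) : QOp N W) (queryCLM W x (applyOp (discreteRun U x q) ψ)) := by
  rw [discreteRun, applyOp_mul, applyOp_mul]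
  rfl

lemma discreteRun_congr {U U' : ℕ → Matrix.unitaryGroup (QIndex N W) ℂ} (x : Fin N → Bool) {q : ℕ}
    (h : ∀ k ≤ q, U k = U' k) : discreteRun U x q = discreteRun U' x q := by
  induction q with
  | zero => rw [discreteRun, discreteRun, h 0 le_rfl]
  | succ q ih =>
    rw [discreteRun, discreteRun, h (q + 1) le_rfl, ih fun k hk => h k (hk.trans q.le_succ)]

lemma discreteRun_update (U : ℕ → Matrix.unitaryGroup (QIndex N W) ℂ)
    (B : Matrix.unitaryGroup (QIndex N W) ℂ) (x : Fin N → Bool) (q : ℕ) :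
    discreteRun (Function.update U q (B * U q)) x q = (B : QOp N W) * discreteRun U x q := by
  cases q with
  | zero => simp [discreteRun]
  | succ q =>
    rw [discreteRun, discreteRun, discreteRun_congr (U' := U) x fun k hk =>
      Function.update_of_ne (by omega) _ _]
    simp [mul_assoc]

/-- Prescribed intermediate states can be followed by an algorithm as soon as each query
reproduces the Gram matrix of the next family. -/
theorem exists_discreteRun_follow {S : Type*} (x : S → Fin N → Bool) (K : ℕ)
    (Ψ : ℕ → S → QState N W) (init fin : S → QState N W) {η : ℝ}
    (a b : S → QState N W) (hinit : ∀ s s', ⟪init s, init s'⟫_ℂ = ⟪a s, a s'⟫_ℂ)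
    (hfin : ∀ s s', ⟪b s, b s'⟫_ℂ = ⟪fin s, fin s'⟫_ℂ)
    (ha : ∀ s, ‖a s - Ψ 0 s‖ ≤ η) (hb : ∀ s, ‖Ψ K s - b s‖ ≤ η)
    (hΨ : ∀ k < K, ∀ s s', ⟪queryCLM W (x s) (Ψ k s), queryCLM W (x s') (Ψ k s')⟫_ℂ
      = ⟪Ψ (k + 1) s, Ψ (k + 1) s'⟫_ℂ) :
    ∃ U : ℕ → Matrix.unitaryGroup (QIndex N W) ℂ, ∀ s,
      ‖applyOp (discreteRun U (x s) K) (init s) - fin s‖ ≤ 2 * η := by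
  obtain ⟨A, hA⟩ := exists_unitary_applyOp_eq init a hinit
  obtain ⟨B, hB⟩ := exists_unitary_applyOp_eq b fin hfin
  have hR : ∀ k, ∃ R : Matrix.unitaryGroup (QIndex N W) ℂ, k < K → ∀ s,
      applyOp (R : QOp N W) (queryCLM W (x s) (Ψ k s)) = Ψ (k + 1) s := by
    intro k
    by_cases hk : k < K
    · obtain ⟨R, h⟩ := exists_unitary_applyOp_eq _ _ (hΨ k hk)
      exact ⟨R, fun _ => h⟩
    · exact ⟨1, fun h => absurd h hk⟩
  choose R hR using hR
  let U : ℕ → Matrix.unitaryGroup (QIndex N W) ℂ := fun k => Nat.casesOn k A R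
  -- The initial error is carried along by isometries and never grows.
  have hrun : ∀ s, ∀ k ≤ K, ‖applyOp (discreteRun U (x s) k) (init s) - Ψ k s‖ ≤ η := by
    intro s k
    induction k with
    | zero =>
      intro _
      change ‖applyOp (A : QOp N W) (init s) - Ψ 0 s‖ ≤ η
      rw [hA]
      exact ha s
    | succ k ih =>
      intro hk
      rw [applyOp_discreteRun_succ, ← hR k hk s]
      change ‖applyOp (R k : QOp N W) _ - _‖ ≤ η
      rw [norm_applyOp_unitary_sub, norm_queryCLM_sub]
      exact ih (by omega)
  refine ⟨Function.update U K (B * U K), fun s => ?_⟩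
  rw [discreteRun_update, applyOp_mul, ← hB, norm_applyOp_unitary_sub]
  calc _ ≤ ‖applyOp (discreteRun U (x s) K) (init s) - Ψ K s‖ + ‖Ψ K s - b s‖ :=
        norm_sub_le_norm_sub_add_norm_sub _ _ _
    _ ≤ 2 * η := by linarith [hrun s K le_rfl, hb s]

end Query

/-! ### State conversion from a catalyst -/

section Embeddings

variable {N : ℕ} {W J V : Type}

/-- The state `|i₀, +⟩ ⊗ |w₀⟩ ⊗ |c⟩ ⊗ u`, on which queries act trivially. -/
def idleState [DecidableEq W] (i₀ : Fin N) (w₀ : W) (c : Bool) (u : EuclideanSpace ℂ J) :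
    QState N (W × (Bool × J ⊕ V)) :=
  WithLp.toLp 2 fun p => p.2.2.elim
    (fun z => if p.1.1 = i₀ then if p.2.1 = w₀ then if z.1 = c then ((Real.sqrt 2 : ℝ) : ℂ)⁻¹ * u z.2
      else 0 else 0 else 0) fun _ => 0

/-- The direct sum of a family of states, in the part of the workspace labelled by `V`. -/
def stackState (g : V → QState N W) : QState N (W × (Bool × J ⊕ V)) :=
  WithLp.toLp 2 fun p => p.2.2.elim (fun _ => 0) fun v => g v (p.1, p.2.1)

variable [Fintype W] [DecidableEq W] [Fintype J] [Fintype V]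

lemma inner_idleState_idleState (i₀ : Fin N) (w₀ : W) (c c' : Bool) (u u' : EuclideanSpace ℂ J) :
    ⟪idleState (V := V) i₀ w₀ c u, idleState i₀ w₀ c' u'⟫_ℂ = if c = c' then ⟪u, u'⟫_ℂ else 0 := by
  have h2 : ((Real.sqrt 2 : ℝ) : ℂ)⁻¹ * ((Real.sqrt 2 : ℝ) : ℂ)⁻¹ = 2⁻¹ := by
    rw [← mul_inv, ← Complex.ofReal_mul, Real.mul_self_sqrt zero_le_two]; simp
  simp only [PiLp.inner_apply, idleState, RCLike.inner_apply, Fintype.sum_prod_type,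
    Fintype.sum_sum_type, Sum.elim_inl, Sum.elim_inr, zero_mul, Finset.sum_const_zero]
  cases c <;> cases c' <;> simp [apply_ite, Finset.sum_ite_irrel]
  all_goals
    rw [Finset.mul_sum]
    refine Finset.sum_congr rfl fun j _ => ?_
    linear_combination (2 * (u' j * (starRingEnd ℂ) (u j))) * h2

omit [Fintype W] [Fintype J] [Fintype V] in
lemma idleState_apply_xor (i₀ : Fin N) (w₀ : W) (c : Bool) (u : EuclideanSpace ℂ J)
    (b : Bool) (p : QIndex N (W × (Bool × J ⊕ V))) :
    idleState i₀ w₀ c u ((p.1.1, b), p.2) = idleState i₀ w₀ c u p := rfl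

lemma inner_idleState_stackState (i₀ : Fin N) (w₀ : W) (c : Bool) (u : EuclideanSpace ℂ J)
    (g : V → QState N W) : ⟪idleState i₀ w₀ c u, stackState g⟫_ℂ = 0 := by
  rw [PiLp.inner_apply]
  refine Finset.sum_eq_zero fun p _ => ?_
  obtain ⟨⟨i, b⟩, w, z | v⟩ := p <;> simp [idleState, stackState]

omit [DecidableEq W] in
lemma inner_stackState_stackState (g g' : V → QState N W) :
    ⟪stackState (J := J) g, stackState g'⟫_ℂ = ∑ v, ⟪g v, g' v⟫_ℂ := by
  simp only [PiLp.inner_apply]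
  conv_rhs => rw [Finset.sum_comm]
  simp [stackState, Fintype.sum_prod_type]

variable [DecidableEq J] [DecidableEq V]

lemma queryCLM_idleState (x : Fin N → Bool) (i₀ : Fin N) (w₀ : W) (c : Bool)
    (u : EuclideanSpace ℂ J) :
    queryCLM (W × (Bool × J ⊕ V)) x (idleState i₀ w₀ c u) = idleState i₀ w₀ c u := by
  ext p
  rw [queryCLM_apply, idleState_apply_xor]

lemma queryCLM_stackState (x : Fin N → Bool) (g : V → QState N W) :
    queryCLM (W × (Bool × J ⊕ V)) x (stackState g) = stackState fun v => queryCLM W x (g v) := by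
  ext p
  rw [queryCLM_apply]
  obtain ⟨⟨i, b⟩, w, z | v⟩ := p
  · rfl
  · simp only [stackState, Sum.elim_inr]
    rw [queryCLM_apply]

/-- State conversion: a catalyst of squared norm `κ` that accounts for the difference of two Gram
matrices yields an algorithm with `K` queries and error `2 √(κ / K)`. -/
theorem exists_discreteRun_of_catalyst {S : Type*} (i₀ : Fin N) (w₀ : W) (x : S → Fin N → Bool)
    (ξ σ : S → EuclideanSpace ℂ J) (g : S → V → QState N W)
    (hg : ∀ s s', ⟪ξ s, ξ s'⟫_ℂ - ⟪σ s, σ s'⟫_ℂ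
      = ∑ v, innerDefect (queryCLM W (x s)) (queryCLM W (x s')) (g s v) (g s' v))
    {κ : ℝ} (hκ : ∀ s, ∑ v, ‖g s v‖ ^ 2 ≤ κ) {K : ℕ} (hK : 0 < K)
    (init fin : S → QState N (W × (Bool × J ⊕ V)))
    (hinit : ∀ s s', ⟪init s, init s'⟫_ℂ = ⟪ξ s, ξ s'⟫_ℂ)
    (hfin : ∀ s s', ⟪fin s, fin s'⟫_ℂ = ⟪σ s, σ s'⟫_ℂ) :
    ∃ U : ℕ → Matrix.unitaryGroup (QIndex N (W × (Bool × J ⊕ V))) ℂ, ∀ s,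
      ‖applyOp (discreteRun U (x s) K) (init s) - fin s‖ ≤ 2 * Real.sqrt (κ / K) := by
  have hK' : (0 : ℝ) < K := by exact_mod_cast hK
  let a : S → QState N (W × (Bool × J ⊕ V)) := fun s => idleState i₀ w₀ false (ξ s)
  let b : S → QState N (W × (Bool × J ⊕ V)) := fun s => idleState i₀ w₀ true (σ s)
  let c : S → QState N (W × (Bool × J ⊕ V)) := fun s => stackState (g s)
  have hc : ∀ s, ‖((Real.sqrt K)⁻¹ : ℂ) • c s‖ ≤ Real.sqrt (κ / K) := by
    intro s
    refine Real.le_sqrt_of_sq_le ?_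
    have h1 : ‖c s‖ ^ 2 = ∑ v, ‖g s v‖ ^ 2 := by
      have h := inner_stackState_stackState (J := J) (g s) (g s)
      simp only [inner_self_eq_norm_sq_to_K] at h
      exact_mod_cast h
    rw [norm_smul, mul_pow, h1, norm_inv, Complex.norm_real, Real.norm_of_nonneg (Real.sqrt_nonneg _),
      inv_pow, Real.sq_sqrt hK'.le, div_eq_inv_mul]
    gcongr
    exact hκ s
  have hac : ∀ s s', ⟪a s, c s'⟫_ℂ = 0 := fun s s' => inner_idleState_stackState _ _ _ _ _
  have hbc : ∀ s s', ⟪b s, c s'⟫_ℂ = 0 := fun s s' => inner_idleState_stackState _ _ _ _ _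
  have hca : ∀ s s', ⟪c s, a s'⟫_ℂ = 0 := fun s s' => inner_eq_zero_symm.1 (hac s' s)
  have hcb : ∀ s s', ⟪c s, b s'⟫_ℂ = 0 := fun s s' => inner_eq_zero_symm.1 (hbc s' s)
  have hab : ∀ s s', ⟪a s, b s'⟫_ℂ = 0 := fun s s' => inner_idleState_idleState _ _ _ _ _ _
  have hba : ∀ s s', ⟪b s, a s'⟫_ℂ = 0 := fun s s' => inner_idleState_idleState _ _ _ _ _ _
  have haa : ∀ s s', ⟪a s, a s'⟫_ℂ = ⟪ξ s, ξ s'⟫_ℂ := fun s s' =>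
    inner_idleState_idleState _ _ _ _ _ _
  have hbb : ∀ s s', ⟪b s, b s'⟫_ℂ = ⟪σ s, σ s'⟫_ℂ := fun s s' =>
    inner_idleState_idleState _ _ _ _ _ _
  have hcc : ∀ s s', ⟪c s, c s'⟫_ℂ = ∑ v, ⟪g s v, g s' v⟫_ℂ := fun s s' =>
    inner_stackState_stackState _ _
  let e : S → QState N (W × (Bool × J ⊕ V)) := fun s => stackState fun v => queryCLM W (x s) (g s v)
  have hae : ∀ s s', ⟪a s, e s'⟫_ℂ = 0 := fun s s' => inner_idleState_stackState _ _ _ _ _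
  have hbe : ∀ s s', ⟪b s, e s'⟫_ℂ = 0 := fun s s' => inner_idleState_stackState _ _ _ _ _
  have hea : ∀ s s', ⟪e s, a s'⟫_ℂ = 0 := fun s s' => inner_eq_zero_symm.1 (hae s' s)
  have heb : ∀ s s', ⟪e s, b s'⟫_ℂ = 0 := fun s s' => inner_eq_zero_symm.1 (hbe s' s)
  have hee : ∀ s s', ⟪e s, e s'⟫_ℂ
      = ∑ v, ⟪queryCLM W (x s) (g s v), queryCLM W (x s') (g s' v)⟫_ℂ := fun s s' =>
    inner_stackState_stackState _ _
  -- A query changes only the catalyst part, lowering the Gram matrix by `1 / K` times the sum of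
  -- defects. This equals the effect of moving weight `1 / K` from source to target, so a unitary
  -- restores the catalyst.
  let Ψ : ℕ → S → QState N (W × (Bool × J ⊕ V)) := fun k s =>
    ((Real.sqrt ((K - k : ℝ) / K) : ℝ) : ℂ) • a s + ((Real.sqrt (k / K) : ℝ) : ℂ) • b s
      + ((Real.sqrt K)⁻¹ : ℂ) • c s
  refine exists_discreteRun_follow x K Ψ init fin a b (fun s s' => by rw [hinit, haa])
    (fun s s' => by rw [hfin, hbb]) (fun s => ?_) (fun s => ?_) fun k hk s s' => ?_
  · have h : a s - Ψ 0 s = -(((Real.sqrt K)⁻¹ : ℂ) • c s) := by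
      simp [Ψ, hK'.ne']
    rw [h, norm_neg]
    exact hc s
  · have h : Ψ K s - b s = ((Real.sqrt K)⁻¹ : ℂ) • c s := by
      simp [Ψ, hK'.ne']
    rw [h]
    exact hc s
  · have hq : ∀ s, queryCLM (W × (Bool × J ⊕ V)) (x s) (Ψ k s)
        = ((Real.sqrt ((K - k : ℝ) / K) : ℝ) : ℂ) • a s + ((Real.sqrt (k / K) : ℝ) : ℂ) • b s
          + ((Real.sqrt K)⁻¹ : ℂ) • e s := by
      intro s
      simp only [Ψ, a, b, c, e, map_add, map_smul, queryCLM_idleState, queryCLM_stackState]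
    have hsq : ∀ r : ℝ, 0 ≤ r → ((Real.sqrt r : ℝ) : ℂ) * ((Real.sqrt r : ℝ) : ℂ) = (r : ℂ) :=
      fun r hr => by rw [← Complex.ofReal_mul, Real.mul_self_sqrt hr]
    have hk' : (k : ℝ) + 1 ≤ K := by exact_mod_cast hk
    have hα := hsq ((K - k : ℝ) / K) (div_nonneg (by linarith) hK'.le)
    have hβ := hsq (k / K) (by positivity)
    have hα' := hsq ((K - (k + 1 : ℕ) : ℝ) / K) (div_nonneg (by push_cast; linarith) hK'.le)
    have hβ' := hsq ((k + 1 : ℕ) / K) (by positivity)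
    have hγ : ((Real.sqrt K)⁻¹ : ℂ) * ((Real.sqrt K)⁻¹ : ℂ) = (K : ℂ)⁻¹ := by
      rw [← mul_inv, hsq _ hK'.le]; simp
    have hg' := hg s s'
    simp only [innerDefect, Finset.sum_sub_distrib] at hg'
    rw [hq, hq]
    simp only [Ψ, inner_add_left, inner_add_right, inner_smul_left, inner_smul_right, hac, hbc, hca,
      hcb, hab, hba, hae, hbe, hea, heb, haa, hbb, hcc, hee, map_inv₀, Complex.conj_ofReal, mul_zero,
      add_zero, zero_add]
    push_cast at hα hβ hα' hβ' ⊢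
    linear_combination ⟪ξ s, ξ s'⟫_ℂ * hα + ⟪σ s, σ s'⟫_ℂ * hβ - ⟪ξ s, ξ s'⟫_ℂ * hα'
      - ⟪σ s, σ s'⟫_ℂ * hβ' + (∑ v, ⟪queryCLM W (x s) (g s v), queryCLM W (x s') (g s' v)⟫_ℂ
        - ∑ v, ⟪g s v, g s' v⟫_ℂ) * hγ + (K : ℂ)⁻¹ * hg'

end Embeddings

/-! ### Simulation of the evolution by discrete queries -/

section Evolution

/-- Entrywise, `|H ψ| ≤ abs(H) |ψ|`, and `|ψ|` has the norm of `ψ`. -/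
lemma l2OpNorm_le_l2OpNorm_absMatrix {ι : Type} [Fintype ι] [DecidableEq ι] (H : Matrix ι ι ℂ) :
    l2OpNorm H ≤ l2OpNorm (absMatrix H) := by
  refine ContinuousLinearMap.opNorm_le_bound _ (norm_nonneg _) fun ψ => ?_
  let φ : EuclideanSpace ℂ ι := WithLp.toLp 2 fun k => ((‖ψ k‖ : ℝ) : ℂ)
  have hφ : ‖φ‖ = ‖ψ‖ := by simp [EuclideanSpace.norm_eq, φ]
  rw [← hφ]
  refine le_trans ?_ (ContinuousLinearMap.le_opNorm _ φ)
  rw [EuclideanSpace.norm_eq, EuclideanSpace.norm_eq]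
  refine Real.sqrt_le_sqrt (Finset.sum_le_sum fun j _ => ?_)
  refine pow_le_pow_left₀ (norm_nonneg _) ?_ 2
  rw [Matrix.ofLp_toEuclideanCLM, Matrix.ofLp_toEuclideanCLM]
  have h : (absMatrix H).mulVec φ.ofLp j = ((∑ k, ‖H j k‖ * ‖ψ k‖ : ℝ) : ℂ) := by
    simp [Matrix.mulVec, dotProduct, absMatrix, φ]
  rw [h, Complex.norm_real]
  refine le_trans ?_ (Real.le_norm_self _)
  refine (norm_sum_le _ _).trans (le_of_eq (Finset.sum_congr rfl fun k _ => norm_mul _ _))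

variable {N : ℕ} {W : Type} [Fintype W] [DecidableEq W]

lemma toEuclideanCLM_exp {ι : Type} [Fintype ι] [DecidableEq ι] (M : Matrix ι ι ℂ) :
    Matrix.toEuclideanCLM (n := ι) (𝕜 := ℂ) (NormedSpace.exp M)
      = NormedSpace.exp (Matrix.toEuclideanCLM (n := ι) (𝕜 := ℂ) M) := by
  let : NormedRing (Matrix ι ι ℂ) := Matrix.linftyOpNormedRing
  let : NormedAlgebra ℂ (Matrix ι ι ℂ) := Matrix.linftyOpNormedAlgebra
  let : NormedAlgebra ℚ (Matrix ι ι ℂ) := .restrictScalars ℚ ℂ _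
  let +nondep : NormedAlgebra ℚ (EuclideanSpace ℂ ι →L[ℂ] EuclideanSpace ℂ ι) :=
    .restrictScalars ℚ ℂ _
  exact NormedSpace.map_exp (Matrix.toEuclideanCLM (n := ι) (𝕜 := ℂ)).toRingEquiv
    (LinearMap.continuous_of_finiteDimensional
      (Matrix.toEuclideanCLM (n := ι) (𝕜 := ℂ)).toAlgEquiv.toLinearMap) M

lemma applyOp_continuousEvolution (HD : QOp N W) (t : ℝ) (x : Fin N → Bool) (ψ : QState N W) :
    applyOp (continuousEvolution HD t x) ψ
      = unitaryFlow (Matrix.toEuclideanCLM (n := QIndex N W) (𝕜 := ℂ) HD + queryCLM W x) t ψ := by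
  rw [applyOp_eq, continuousEvolution, toEuclideanCLM_exp, map_smul, map_add]
  rfl

lemma isSelfAdjoint_toEuclideanCLM {ι : Type} [Fintype ι] [DecidableEq ι] {M : Matrix ι ι ℂ}
    (hM : M.IsHermitian) : IsSelfAdjoint (Matrix.toEuclideanCLM (n := ι) (𝕜 := ℂ) M) := by
  rw [IsSelfAdjoint, ← map_star]
  exact congrArg _ hM

lemma norm_applyOp_continuousEvolution {HD : QOp N W} (hH : HD.IsHermitian) (t : ℝ)
    (x : Fin N → Bool) (ψ : QState N W) : ‖applyOp (continuousEvolution HD t x) ψ‖ = ‖ψ‖ := by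
  rw [applyOp_continuousEvolution, norm_unitaryFlow ((isSelfAdjoint_toEuclideanCLM hH).add
    (isSelfAdjoint_of_reflection (queryCLM_queryCLM x) (inner_queryCLM x)))]

theorem exists_catalyst_continuousEvolution {HD : QOp N W} (hH : HD.IsHermitian) {t ε : ℝ}
    (ht : 0 ≤ t) (hε : 0 < ε) :
    ∃ (n : ℕ) (Z : (Fin N → Bool) → QState N W →L[ℂ] QState N W)
      (f : (Fin N → Bool) → QState N W → Option (Fin n) × Bool → QState N W),
      (∀ x ψ, ‖Z x ψ‖ = ‖ψ‖) ∧
      (∀ x ψ, ‖Z x ψ - applyOp (continuousEvolution HD t x) ψ‖ ≤ ε * ‖ψ‖) ∧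
      (∀ x x' ψ ψ', ⟪ψ, ψ'⟫_ℂ - ⟪Z x ψ, Z x' ψ'⟫_ℂ
        = ∑ v, innerDefect (queryCLM W x) (queryCLM W x') (f x ψ v) (f x' ψ' v)) ∧
      ∀ x ψ, ∑ v, ‖f x ψ v‖ ^ 2 ≤ 7 * (1 + l2OpNorm (absMatrix HD) * t) * ‖ψ‖ ^ 2 := by
  simp_rw [applyOp_continuousEvolution]
  exact exists_catalyst_evolution (queryCLM W) queryCLM_queryCLM inner_queryCLM
    (isSelfAdjoint_toEuclideanCLM hH) ht (l2OpNorm_le_l2OpNorm_absMatrix HD) hε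

lemma exists_query_count {κ η : ℝ} (hκ : 0 < κ) (hη : 0 < η) :
    ∃ K : ℕ, 0 < K ∧ 2 * Real.sqrt (κ / K) ≤ η ∧ (K : ℝ) ≤ 4 * κ / η ^ 2 + 1 := by
  have h0 : 0 < 4 * κ / η ^ 2 := by positivity
  have hK : 0 < ⌈4 * κ / η ^ 2⌉₊ := Nat.ceil_pos.2 h0
  refine ⟨⌈4 * κ / η ^ 2⌉₊, hK, ?_, (Nat.ceil_lt_add_one h0.le).le⟩
  have h1 := Nat.le_ceil (4 * κ / η ^ 2)
  have hK' : (0 : ℝ) < ⌈4 * κ / η ^ 2⌉₊ := by exact_mod_cast hK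
  have h2 : Real.sqrt (κ / ⌈4 * κ / η ^ 2⌉₊) ≤ η / 2 := by
    rw [Real.sqrt_le_left (by positivity), div_le_iff₀ hK']
    rw [div_le_iff₀ (by positivity)] at h1
    linarith
  linarith

omit [DecidableEq W] in
lemma inner_attach {A : Type} [Fintype A] [DecidableEq A] (a : A) (φ ψ : QState N W) :
    ⟪attach a φ, attach a ψ⟫_ℂ = ⟪φ, ψ⟫_ℂ := by
  rw [PiLp.inner_apply, PiLp.inner_apply]
  symm
  refine Fintype.sum_of_injective (fun p : QIndex N W => (p.1, (p.2, a))) ?_ _ _ ?_ ?_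
  · rintro ⟨p, w⟩ ⟨p', w'⟩ h
    simpa using h
  · rintro ⟨p, w, a'⟩ h
    have h' : a' ≠ a := fun e => h ⟨(p, w), by rw [e]⟩
    simp [attach, h']
  · intro p
    simp [attach]

omit [DecidableEq W] in
lemma norm_attach_sub {A : Type} [Fintype A] [DecidableEq A] (a : A) (φ ψ : QState N W) :
    ‖attach a φ - attach a ψ‖ = ‖φ - ψ‖ := by
  have h : attach a φ - attach a ψ = attach a (φ - ψ) := by
    ext p
    by_cases hp : p.2.2 = a <;> simp [attach, hp]
  rw [h, @norm_eq_sqrt_re_inner ℂ, @norm_eq_sqrt_re_inner ℂ, inner_attach]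

theorem exists_discreteSimulable {HD : QOp N W} (hH : HD.IsHermitian) {t ε : ℝ}
    (ht : 0 ≤ t) (hε : 0 < ε) :
    ∃ q : ℕ, (q : ℝ) ≤ (112 / ε ^ 2 + 1) * (1 + l2OpNorm (absMatrix HD) * t) ∧
      DiscreteSimulable HD t ε q := by
  have hΛ : 0 ≤ l2OpNorm (absMatrix HD) * t := mul_nonneg (norm_nonneg _) ht
  -- On an empty register there are no unit vectors to simulate.
  rcases isEmpty_or_nonempty (QIndex N W) with hI | ⟨⟨⟨i₀, b₀⟩, w₀⟩⟩
  · refine ⟨0, by push_cast; positivity, Unit, inferInstance, inferInstance, (), fun _ => 1,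
      fun x ψ hψ => ?_⟩
    simp [EuclideanSpace.norm_eq] at hψ
  obtain ⟨n, Z, f, -, hZ, hf, hfn⟩ :=
    exists_catalyst_continuousEvolution hH ht (half_pos hε)
  obtain ⟨K, hK, hK1, hK2⟩ := exists_query_count
    (κ := 7 * (1 + l2OpNorm (absMatrix HD) * t)) (by positivity) (half_pos hε)
  refine ⟨K, ?_, Bool × QIndex N W ⊕ Option (Fin n) × Bool, inferInstance, inferInstance,
    Sum.inl (false, ((i₀, b₀), w₀)), ?_⟩
  · have h : 4 * (7 * (1 + l2OpNorm (absMatrix HD) * t)) / (ε / 2) ^ 2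
        = 112 / ε ^ 2 * (1 + l2OpNorm (absMatrix HD) * t) := by
      field_simp
      ring
    linarith
  -- Indexing by pairs of an input and a unit vector makes one algorithm work for all initial
  -- states. Half of `ε` goes to the product formula, half to state conversion.
  obtain ⟨U, hU⟩ := exists_discreteRun_of_catalyst
    (S := (Fin N → Bool) × {ψ : QState N W // ‖ψ‖ = 1}) i₀ w₀ Prod.fst (fun s => s.2.1)
    (fun s => Z s.1 s.2.1) (fun s => f s.1 s.2.1) (fun s s' => hf s.1 s'.1 s.2.1 s'.2.1)
    (fun s => by simpa [s.2.2] using hfn s.1 s.2.1) hK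
    (fun s => attach (Sum.inl (false, ((i₀, b₀), w₀))) s.2.1)
    (fun s => attach (Sum.inl (false, ((i₀, b₀), w₀))) (Z s.1 s.2.1))
    (fun s s' => inner_attach _ _ _) (fun s s' => inner_attach _ _ _)
  refine ⟨U, fun x ψ hψ => ?_⟩
  have h1 := (hU (x, ⟨ψ, hψ⟩)).trans hK1
  have h2 := hZ x ψ
  rw [hψ, mul_one, ← norm_attach_sub (Sum.inl (false, ((i₀, b₀), w₀)) :
    Bool × QIndex N W ⊕ Option (Fin n) × Bool)] at h2
  exact (norm_sub_le_norm_sub_add_norm_sub _ _ _).trans ((add_le_add h1 h2).trans_eq (add_halves ε))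

end Evolution

/-! ### Outcome probabilities and majority of three -/

section Majority

variable {ι Y : Type} [Fintype ι]

/-- The probability is the squared norm of a projection `R φ`, and `‖R φ‖` is 1-Lipschitz in `φ`. -/
lemma outcomeProb_le_add (φ φ' : EuclideanSpace ℂ ι) (hφ : ‖φ‖ ≤ 1) (out : ι → Y) (y : Y) :
    outcomeProb φ out y ≤ outcomeProb φ' out y + 2 * ‖φ - φ'‖ := by
  classical
  let R : EuclideanSpace ℂ ι → EuclideanSpace ℂ ι := fun u =>
    WithLp.toLp 2 fun c => if out c = y then u c else 0
  have hR : ∀ u, ‖R u‖ ^ 2 = outcomeProb u out y := by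
    intro u
    rw [EuclideanSpace.norm_sq_eq, outcomeProb]
    refine Finset.sum_congr rfl fun c _ => ?_
    by_cases h : out c = y <;> simp [R, h]
  have hRn : ∀ u, ‖R u‖ ≤ ‖u‖ := by
    intro u
    rw [EuclideanSpace.norm_eq, EuclideanSpace.norm_eq]
    refine Real.sqrt_le_sqrt (Finset.sum_le_sum fun c _ => ?_)
    by_cases h : out c = y <;> simp [R, h]
  have hRs : R φ - R φ' = R (φ - φ') := by
    ext c
    by_cases h : out c = y <;> simp [R, h]
  have h1 : ‖R φ‖ ≤ ‖R φ'‖ + ‖φ - φ'‖ := by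
    have := norm_sub_norm_le (R φ) (R φ')
    rw [hRs] at this
    linarith [hRn (φ - φ')]
  have h2 := (hRn φ).trans hφ
  rw [← hR, ← hR]
  rcases le_total ‖R φ‖ ‖R φ'‖ with h | h
  · nlinarith [norm_nonneg (R φ), norm_nonneg (φ - φ')]
  · nlinarith [norm_nonneg (R φ'), norm_nonneg (φ - φ')]

/-- The threefold tensor power of a state. -/
def tensorCube (u : EuclideanSpace ℂ ι) : EuclideanSpace ℂ (ι × ι × ι) :=
  WithLp.toLp 2 fun p => u p.1 * (u p.2.1 * u p.2.2)

lemma inner_tensorCube (u u' : EuclideanSpace ℂ ι) :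
    ⟪tensorCube u, tensorCube u'⟫_ℂ = ⟪u, u'⟫_ℂ ^ 3 := by
  simp only [PiLp.inner_apply, RCLike.inner_apply, tensorCube, Fintype.sum_prod_type, map_mul]
  rw [pow_succ', sq, Finset.sum_mul_sum, Finset.sum_mul_sum]
  simp only [Finset.mul_sum]
  refine Finset.sum_congr rfl fun i _ => Finset.sum_congr rfl fun j _ =>
    Finset.sum_congr rfl fun k _ => ?_
  ring

open Classical in
/-- The majority of three answers, if there is one. -/
def majority (p : Y × Y × Y) : Y := if p.1 = p.2.1 then p.1 else p.2.2

lemma le_outcomeProb_tensorCube {u : EuclideanSpace ℂ ι} (hu : ‖u‖ = 1) (out : ι → Y) (y : Y) :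
    3 * outcomeProb u out y ^ 2 - 2 * outcomeProb u out y ^ 3
      ≤ outcomeProb (tensorCube u) (fun p => majority (out p.1, out p.2.1, out p.2.2)) y := by
  classical
  set m : ι → ℝ := fun c => ‖u c‖ ^ 2 with hm
  set a : ι → ℝ := fun c => if out c = y then ‖u c‖ ^ 2 else 0 with ha
  have hm1 : ∑ c, m c = 1 := by
    rw [hm, ← EuclideanSpace.norm_sq_eq, hu, one_pow]
  have hp : outcomeProb u out y = ∑ c, a c := by
    rw [outcomeProb]
  -- The left side is the weight of the triple if at least two answers equal `y`, and `0` otherwise.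
  have key : ∀ i j k, a i * (a j * m k) + a i * (m j * a k) + m i * (a j * a k)
      - 2 * (a i * (a j * a k)) ≤ if majority (out i, out j, out k) = y
        then ‖u i * (u j * u k)‖ ^ 2 else 0 := by
    intro i j k
    have hpos : 0 ≤ ‖u i‖ ^ 2 * (‖u j‖ ^ 2 * ‖u k‖ ^ 2) := by positivity
    simp only [norm_mul, mul_pow, majority, ha, hm]
    by_cases hi : out i = y <;> by_cases hj : out j = y <;> by_cases hk : out k = y <;>
      by_cases hij : out i = out j <;> simp_all <;> linarith
  have hS : ∑ i, ∑ j, ∑ k, (a i * (a j * m k) + a i * (m j * a k) + m i * (a j * a k)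
      - 2 * (a i * (a j * a k))) = 3 * (∑ c, a c) ^ 2 - 2 * (∑ c, a c) ^ 3 := by
    simp only [Finset.sum_add_distrib, Finset.sum_sub_distrib, ← Finset.mul_sum, ← Finset.sum_mul,
      hm1]
    ring
  rw [hp, ← hS, outcomeProb]
  simp only [Fintype.sum_prod_type]
  exact Finset.sum_le_sum fun i _ => Finset.sum_le_sum fun j _ => Finset.sum_le_sum fun k _ => by
    refine (key i j k).trans (le_of_eq ?_)
    split_ifs <;> rfl

end Majority

/-! ### Embedding states into a larger register -/

section Relabel

variable {ι κ Y : Type} [Fintype ι] [Fintype κ]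

/-- A state on a part of the computational basis, regarded as a state on the whole of it. -/
def relabelState (h : κ → ι) (φ : EuclideanSpace ℂ κ) : EuclideanSpace ℂ ι :=
  WithLp.toLp 2 (Function.extend h φ.ofLp 0)

lemma inner_relabelState {h : κ → ι} (hh : Function.Injective h) (φ ψ : EuclideanSpace ℂ κ) :
    ⟪relabelState h φ, relabelState h ψ⟫_ℂ = ⟪φ, ψ⟫_ℂ := by
  rw [PiLp.inner_apply, PiLp.inner_apply]
  symm
  refine Fintype.sum_of_injective h hh _ _ (fun p hp => ?_) fun k => ?_
  · simp [relabelState, Function.extend_apply' _ _ _ hp]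
  · simp [relabelState, hh.extend_apply]

lemma outcomeProb_relabelState {h : κ → ι} (hh : Function.Injective h) (φ : EuclideanSpace ℂ κ)
    (out : κ → Y) (out' : ι → Y) (y : Y) :
    outcomeProb (relabelState h φ) (Function.extend h out out') y = outcomeProb φ out y := by
  classical
  rw [outcomeProb, outcomeProb]
  symm
  refine Fintype.sum_of_injective h hh _ _ (fun p hp => ?_) fun k => ?_
  · simp [relabelState, Function.extend_apply' _ _ _ hp]
  · simp [relabelState, hh.extend_apply]

end Relabel

/-! ### Computing functions with error at most 1/3 -/

section Computation

variable {N : ℕ} {W : Type} [Fintype W] [DecidableEq W]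

/-- The catalyst for converting the third tensor power, built from a catalyst for one copy. -/
def cubeCatalyst {V I : Type} (g : V → QState N W) (σ : EuclideanSpace ℂ I)
    (v : V × (Option I ⊕ I × I)) : QState N W :=
  v.2.elim (fun o => o.elim 1 σ) (fun j => σ j.1 * σ j.2) • g v.1

-- The factors `1`, `σ`, `σ ⊗ σ` implement `1 - γ ^ 3 = (1 - γ) (1 + γ + γ ^ 2)` for `γ = ⟪σ, σ'⟫`.
-- Three copies thus cost three times the catalyst of one.
omit [DecidableEq W] in
lemma sum_innerDefect_cubeCatalyst {V I : Type} [Fintype V] [Fintype I]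
    (O O' : QState N W →L[ℂ] QState N W) (g g' : V → QState N W) (σ σ' : EuclideanSpace ℂ I) :
    ∑ v, innerDefect O O' (cubeCatalyst g σ v) (cubeCatalyst g' σ' v)
      = (∑ v, innerDefect O O' (g v) (g' v)) * (1 + ⟪σ, σ'⟫_ℂ + ⟪σ, σ'⟫_ℂ ^ 2) := by
  have h : ∀ (c c' : ℂ) (u u' : QState N W), innerDefect O O' (c • u) (c' • u')
      = innerDefect O O' u u' * (c' * (starRingEnd ℂ) c) := by
    intro c c' u u'
    simp only [innerDefect, map_smul, inner_smul_left, inner_smul_right]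
    ring
  simp only [cubeCatalyst, h, Fintype.sum_prod_type, ← Finset.mul_sum, ← Finset.sum_mul,
    Fintype.sum_sum_type, Fintype.sum_option, Option.elim, Sum.elim_inl, Sum.elim_inr, PiLp.inner_apply, RCLike.inner_apply]
  congr 1
  simp only [map_one, mul_one]
  congr 1
  rw [sq, Finset.sum_mul_sum]
  refine Finset.sum_congr rfl fun i _ => Finset.sum_congr rfl fun j _ => ?_
  rw [map_mul]
  ring

omit [DecidableEq W] in
lemma sum_norm_sq_cubeCatalyst {V I : Type} [Fintype V] [Fintype I]
    (g : V → QState N W) {σ : EuclideanSpace ℂ I} (hσ : ‖σ‖ = 1) :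
    ∑ v, ‖cubeCatalyst g σ v‖ ^ 2 = 3 * ∑ v, ‖g v‖ ^ 2 := by
  -- With both operators `0`, the defect is the inner product itself.
  have h := sum_innerDefect_cubeCatalyst (0 : QState N W →L[ℂ] QState N W) 0 g g σ σ
  simp only [innerDefect, _root_.zero_apply,
    inner_self_eq_norm_sq_to_K, hσ] at h
  have h' : (∑ v, ‖cubeCatalyst g σ v‖ ^ 2 : ℝ) = (∑ v, ‖g v‖ ^ 2) * (1 + 1 + 1) := by
    norm_num at h ⊢
    exact_mod_cast h
  rw [h']
  ring

set_option synthInstance.maxSize 4000 in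
theorem exists_discreteComputable {Y : Type} {D : Set (Fin N → Bool)} {f : (Fin N → Bool) → Y}
    (P : ContinuousQueryAlgorithm N W Y) (hP : P.Computes D f) :
    ∃ q : ℕ, (q : ℝ) ≤ 302401 * (1 + l2OpNorm (absMatrix P.HD) * P.time) ∧
      DiscreteComputable q D f := by
  have hΛ : 0 ≤ l2OpNorm (absMatrix P.HD) * P.time := mul_nonneg (norm_nonneg _) P.time_nonneg
  have hI : Nonempty (QIndex N W) := by
    by_contra hI
    rw [not_nonempty_iff] at hI
    have := P.norm_init
    simp [EuclideanSpace.norm_eq] at this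
  obtain ⟨j₀⟩ := hI
  obtain ⟨n, Z, g, hZn, hZ, hg, hgn⟩ := exists_catalyst_continuousEvolution P.hermitian
    P.time_nonneg (show (0 : ℝ) < 1 / 300 by norm_num)
  let σ : (Fin N → Bool) → QState N W := fun x => applyOp (P.post : QOp N W) (Z x P.init)
  have hσ : ∀ x, ‖σ x‖ = 1 := fun x => by
    rw [norm_applyOp_unitary, hZn, P.norm_init]
  have hσin : ∀ x x', ⟪σ x, σ x'⟫_ℂ = ⟪Z x P.init, Z x' P.init⟫_ℂ := fun x x' =>
    inner_applyOp_unitary _ _ _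
  have hp : ∀ x ∈ D, 2 / 3 - 1 / 150 ≤ outcomeProb (σ x) P.out (f x) := by
    intro x hx
    have h1 := hP x hx
    have h2 : ‖applyOp ((P.post : QOp N W) * continuousEvolution P.HD P.time x) P.init - σ x‖
        ≤ 1 / 300 := by
      rw [applyOp_mul, norm_applyOp_unitary_sub, norm_sub_rev]
      simpa [P.norm_init] using hZ x P.init
    have h3 := outcomeProb_le_add
      (applyOp ((P.post : QOp N W) * continuousEvolution P.HD P.time x) P.init) (σ x) (by rw [applyOp_mul,
        norm_applyOp_unitary, norm_applyOp_continuousEvolution P.hermitian,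
        P.norm_init]) P.out (f x)
    linarith
  -- `21 = 3 * 7` for three copies. The error `1 / 60` costs `1 / 30` in probability, exactly `7 /
  -- 10 - 2 / 3`, and `4 * 21 * 60 ^ 2 = 302400`.
  obtain ⟨K, hK, hK1, hK2⟩ := exists_query_count
    (κ := 21 * (1 + l2OpNorm (absMatrix P.HD) * P.time)) (by positivity)
    (show (0 : ℝ) < 1 / 60 by norm_num)
  let I := QIndex N W
  let V := (Option (Fin n) × Bool) × (Option I ⊕ I × I)
  let h : I × I × I → QIndex N (W × (Bool × (I × I × I) ⊕ V)) := fun j =>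
    (j₀.1, (j₀.2, Sum.inl (false, j)))
  have hh : Function.Injective h := by
    intro j j' e
    simpa [h] using e
  let e₀ : EuclideanSpace ℂ (I × I × I) := EuclideanSpace.single (j₀, j₀, j₀) 1
  have he₀ : ⟪e₀, e₀⟫_ℂ = 1 := by
    rw [inner_self_eq_norm_sq_to_K, PiLp.norm_single]
    simp
  -- The initial state is the same for all inputs, so any fixed unit vector may serve as the source.
  obtain ⟨U, hU⟩ := exists_discreteRun_of_catalyst j₀.1.1 j₀.2 (fun x : Fin N → Bool => x)
    (fun _ => e₀) (fun x => tensorCube (σ x)) (fun x => cubeCatalyst (g x P.init) (σ x))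
    (fun x x' => by
      rw [sum_innerDefect_cubeCatalyst, ← hg, inner_tensorCube, he₀, hσin,
        inner_self_eq_norm_sq_to_K, P.norm_init]
      push_cast
      ring)
    (κ := 21 * (1 + l2OpNorm (absMatrix P.HD) * P.time)) (fun x => by
      rw [sum_norm_sq_cubeCatalyst _ (hσ x)]
      have := hgn x P.init
      rw [P.norm_init] at this
      linarith) hK (fun _ => relabelState h e₀) (fun x => relabelState h (tensorCube (σ x)))
    (fun x x' => inner_relabelState hh _ _) (fun x x' => inner_relabelState hh _ _)
  have hnorm : ∀ {ι : Type} [Fintype ι] (u : EuclideanSpace ℂ ι), ⟪u, u⟫_ℂ = 1 → ‖u‖ = 1 := by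
    intro ι _ u hu
    rw [@norm_eq_sqrt_re_inner ℂ, hu]
    simp
  refine ⟨K, ?_, W × (Bool × (I × I × I) ⊕ V), inferInstance, inferInstance, U,
    relabelState h e₀, Function.extend h
      (fun p => majority (P.out p.1, P.out p.2.1, P.out p.2.2)) fun _ => P.out j₀, ?_, ?_⟩
  · norm_num at hK2
    linarith
  · exact hnorm _ (by rw [inner_relabelState hh, he₀])
  · intro x hx
    have h1 := (hU x).trans hK1
    rw [norm_sub_rev] at h1
    have h2 : ‖relabelState h (tensorCube (σ x))‖ = 1 := hnorm _ (by
      rw [inner_relabelState hh, inner_tensorCube, inner_self_eq_norm_sq_to_K, hσ]; simp)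
    have h3 := outcomeProb_le_add _ (applyOp (discreteRun U x K) (relabelState h e₀)) h2.le
      (Function.extend h (fun p => majority (P.out p.1, P.out p.2.1, P.out p.2.2))
        fun _ => P.out j₀) (f x)
    rw [outcomeProb_relabelState hh] at h3
    have h4 := le_outcomeProb_tensorCube (hσ x) P.out (f x)
    have h5 := hp x hx
    have h6 : outcomeProb (σ x) P.out (f x) ≤ 1 := by
      classical
      have e := EuclideanSpace.norm_sq_eq (σ x)
      rw [hσ, one_pow] at e
      rw [e, outcomeProb]
      refine Finset.sum_le_sum fun c _ => ?_
      split_ifs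
      · exact le_rfl
      · positivity
    -- Here `p ≥ 2 / 3 - 1 / 150 = 0.66`, where `3 p ^ 2 - 2 p ^ 3` exceeds `0.73`.
    have h7 : (7 / 10 : ℝ) ≤ 3 * outcomeProb (σ x) P.out (f x) ^ 2
        - 2 * outcomeProb (σ x) P.out (f x) ^ 3 := by
      nlinarith [mul_nonneg (sub_nonneg.2 h5) (sub_nonneg.2 h6),
        mul_nonneg (mul_nonneg (sub_nonneg.2 h5) (sub_nonneg.2 h6)) (sub_nonneg.2 h5)]
    linarith

end Computation

end

theorem theorem6 :
    (∀ ε : ℝ, 0 < ε → ∃ C : ℝ, 0 < C ∧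
      ∀ (N : ℕ) (W : Type) [Fintype W] [DecidableEq W] (HD : QOp N W) (t : ℝ),
        HD.IsHermitian → 0 ≤ t →
        ∃ q : ℕ, (q : ℝ) ≤ C * (1 + l2OpNorm (absMatrix HD) * t) ∧
          DiscreteSimulable HD t ε q) ∧
    (∃ C : ℝ, 0 < C ∧
      ∀ (N : ℕ) (W : Type) [Fintype W] [DecidableEq W] (Y : Type)
        (D : Set (Fin N → Bool)) (f : (Fin N → Bool) → Y)
        (P : ContinuousQueryAlgorithm N W Y), P.Computes D f →
        ∃ q : ℕ, (q : ℝ) ≤ C * (1 + l2OpNorm (absMatrix P.HD) * P.time) ∧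
          DiscreteComputable q D f) := by
  exact ⟨fun ε hε => ⟨112 / ε ^ 2 + 1, by positivity, fun _ _ _ _ _ _ hH ht =>
    exists_discreteSimulable hH ht hε⟩,
    302401, by norm_num, fun _ _ _ _ _ _ _ P hP => exists_discreteComputable P hP⟩
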